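/- All graphs are finite, simple and undirected, and $P_n$ denotes the path with $n$ vertices. Fix $n \ge 4$. For a graph $G$, let $HL(G)$ be the graph whose vertices are the edges of $G$, where two distinct edges $e,f$ of $G$ are joined in $HL(G)$ if and only if they share an endpoint and both lie in a common subgraph of $G$ isomorphic to $P_n$. Put $HL^0(G)=G$ and $HL^{k+1}(G)=HL(HL^k(G))$. The sequence $\{HL^k(G)\}_{k\ge 0}$ terminates if the empty graph occurs in it; it converges if it does not terminate and $HL^N(G)\cong HL^{N+1}(G)$ for some $N \ge 0$. Let $\Lambda_n$ be the class of all graphs $G$ whose sequence $\{HL^k(G)\}$ converges. A graph is unicyclic if it is connected and contains exactly one cycle $C$; an arm of a unicyclic graph $G$ is a connected component of $G-C$, the graph obtained from $G$ by deleting the vertices of $C$. **Lemma.** Let $G\in\Lambda_n$ be unicyclic. If $e$ is an edge of $G$ lying in an arm of $G$ (so both endpoints of $e$ belong to the arm), then $e$, as a vertex of $HL(G)$, does not lie on any cycle of $HL(G)$. -/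

import Mathlib

namespace SimpleGraph

universe u w

/-- Two edges `e`, `f` of `G` are `H`-adjacent if they are adjacent edges of `G` (distinct, with
a common endpoint) and both lie in a common subgraph of `G` isomorphic to `H`. -/
def HAdjacent {V : Type u} {W : Type w} (H : SimpleGraph W) (G : SimpleGraph V)
    (e f : G.edgeSet) : Prop :=
  G.lineGraph.Adj e f ∧
    ∃ S : G.Subgraph, Nonempty (H ≃g S.coe) ∧ (e : Sym2 V) ∈ S.edgeSet ∧ (f : Sym2 V) ∈ S.edgeSet

/-- The `H`-line graph `HL(G)`: its vertices are the edges of `G`, and two of them are joined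
if they are `H`-adjacent in `G`. -/
def hLineGraph {V : Type u} {W : Type w} (H : SimpleGraph W) (G : SimpleGraph V) :
    SimpleGraph G.edgeSet where
  Adj e f := HAdjacent H G e f
  symm := ⟨fun _ _ h => ⟨h.1.symm, h.2.imp fun _ hS => ⟨hS.1, hS.2.2, hS.2.1⟩⟩⟩
  loopless := ⟨fun e h => G.lineGraph.loopless.irrefl e h.1⟩

/-- A graph bundled with its vertex type. It is needed because the vertex type changes from
one iterate of the `H`-line graph to the next. -/
structure BundledGraph where
  /-- The vertex type. -/
  V : Type u
  /-- The graph. -/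
  graph : SimpleGraph V

/-- The iterated `H`-line graph: `HL⁰(G) = G` and `HLᵏ⁺¹(G) = HL(HLᵏ(G))`. -/
def iterHLineGraph {V : Type u} {W : Type w} (H : SimpleGraph W) (G : SimpleGraph V) :
    ℕ → BundledGraph.{u}
  | 0 => ⟨V, G⟩
  | k + 1 => ⟨(iterHLineGraph H G k).graph.edgeSet, hLineGraph H (iterHLineGraph H G k).graph⟩

/-- The sequence `HLᵏ(G)` terminates if the graph without vertices occurs in it. (A graph without
edges is followed by the graph without vertices, so asking for a term without edges is
equivalent.) -/
def HLTerminates {V : Type u} {W : Type w} (H : SimpleGraph W) (G : SimpleGraph V) : Prop :=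
  ∃ k, IsEmpty (iterHLineGraph H G k).V

/-- The sequence `HLᵏ(G)` converges if it does not terminate and two successive terms of it are
isomorphic. -/
def HLConverges {V : Type u} {W : Type w} (H : SimpleGraph W) (G : SimpleGraph V) : Prop :=
  ¬ HLTerminates H G ∧
    ∃ N, Nonempty ((iterHLineGraph H G N).graph ≃g (iterHLineGraph H G (N + 1)).graph)

/-- Membership of a graph in `Λ_n`: its sequence converges for `H = P_n`, the path with `n`
vertices. -/
def MemLambda (n : ℕ) {V : Type u} (G : SimpleGraph V) : Prop :=
  HLConverges (pathGraph n) G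

/-- `C` is a cycle of `G`, regarded as a subgraph. -/
def IsCycleSubgraph {V : Type u} (G : SimpleGraph V) (C : G.Subgraph) : Prop :=
  ∃ (v : V) (c : G.Walk v v), c.IsCycle ∧ c.toSubgraph = C

/-- A graph is unicyclic if it is connected and has exactly one cycle. -/
def IsUnicyclic {V : Type u} (G : SimpleGraph V) : Prop :=
  G.Connected ∧ ∃! C : G.Subgraph, IsCycleSubgraph G C

/-- For a unicyclic graph `G` with cycle `C`, an arm is a connected component of `G - C` (the
vertices of `C` are deleted), regarded as a subgraph of `G`. -/
def IsArm {V : Type u} (G : SimpleGraph V) (A : G.Subgraph) : Prop :=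
  ∃ C : G.Subgraph, IsCycleSubgraph G C ∧
    ∃ K : (G.induce C.vertsᶜ).ConnectedComponent,
      A = (⊤ : G.Subgraph).induce (Subtype.val '' K.supp)

end SimpleGraph

/-! The endpoints of an arm edge lie on no cycle of `G`. Suppose a cycle of `HL(G)` passes through
this edge, and let `w` be the endpoint it shares with its successor. Every edge at `w` is a bridge,
so the cycle cannot leave the edges at `w` and come back (`mem_of_mem_support_of_isCycle`). Assign
to each edge of the cycle the length of a longest path leaving `w` along it. Consecutive edges have
lengths adding up to at least `n - 1`, hence so do any two among a shortest edge and its two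
neighbours on the cycle. The three longest paths meet only in `w`, and `HL` turns this spider into a
triangle with three tails (`hasSun_hLineGraph_of_spider`).

Such a configuration forces unbounded growth. Each application of `HL` moves one edge of every tail
into the cycle (`HasSun.hLineGraph`). Once a shortest tail is used up, there remains a lollipop or a
chorded cycle on at least `n + 1` vertices; a triangle with a trivial tail is treated separately
through a bull. A lollipop keeps its order under `HL` while its tail shrinks; with a tail of one
edge it gives a chorded cycle, and this gives a lollipop with one more vertex. A convergent sequence
of finite graphs is eventually constant up to isomorphism, so its orders are bounded: a
contradiction. -/

namespace SimpleGraph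

universe u w

/-! ### Adjacency in the `P_n`-line graph and paths leaving a vertex -/

section PathLineGraph

variable {V : Type u} {G : SimpleGraph V} {n : ℕ}

/-- Two consecutive edges of a path with at least `n` vertices are adjacent in the `P_n`-line
graph. -/
theorem hLineGraph_pathGraph_adj_of_path {k : ℕ} (hn3 : 3 ≤ n) (hnk : n ≤ k) (q : ℕ → V)
    (hinj : ∀ i < k, ∀ j < k, q i = q j → i = j) (hadj : ∀ i, i + 1 < k → G.Adj (q i) (q (i + 1)))
    {t : ℕ} (ht : t + 2 < k) {e f : G.edgeSet} (he : (e : Sym2 V) = s(q t, q (t + 1)))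
    (hf : (f : Sym2 V) = s(q (t + 1), q (t + 2))) :
    (hLineGraph (pathGraph n) G).Adj e f := by
  refine ⟨lineGraph_adj_iff_exists.2 ⟨fun h => ?_, q (t + 1), by simp [he], by simp [hf]⟩, ?_⟩
  · have h1 : s(q t, q (t + 1)) = s(q (t + 1), q (t + 2)) := by rw [← he, ← hf, h]
    rw [Sym2.eq_iff] at h1
    rcases h1 with ⟨h1, -⟩ | ⟨h1, -⟩ <;>
    · have := hinj _ (by omega) _ (by omega) h1
      omega
  -- A window of `n` consecutive vertices containing `t`, `t + 1`, `t + 2`: it starts at `t` if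
  -- there is room, and otherwise consists of the last `n` vertices.
  · obtain ⟨s, hs1, hs2, hs3⟩ : ∃ s, s ≤ t ∧ t + 2 < s + n ∧ s + n ≤ k := by
      by_cases h : t + n ≤ k
      · exact ⟨t, by omega, by omega, h⟩
      · exact ⟨k - n, by omega, by omega, by omega⟩
    let φ : Copy (pathGraph n) G :=
      ⟨⟨fun i => q (s + i), fun {a b} h => by
        rw [pathGraph_adj] at h
        rcases h with h | h
        · rw [← h]; exact hadj (s + a) (by have := b.2; omega)
        · rw [← h]; exact (hadj (s + b) (by have := a.2; omega)).symm⟩,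
        fun a b h => Fin.ext (by
          have := hinj (s + a) (by have := a.2; omega) (s + b) (by have := b.2; omega) h
          omega)⟩
    have key : ∀ i, s ≤ i → i + 1 < s + n → φ.toSubgraph.Adj (q i) (q (i + 1)) := by
      intro i h1 h2
      refine ⟨⟨i - s, by omega⟩, ⟨i + 1 - s, by omega⟩, ?_, ?_, ?_⟩
      · simp only [Subgraph.top_adj]
        rw [pathGraph_adj]
        left
        simp only
        omega
      · change q (s + (i - s)) = q i
        congr 1; omega
      · change q (s + (i + 1 - s)) = q (i + 1)
        congr 1; omega
    refine ⟨φ.toSubgraph, ⟨φ.isoToSubgraph⟩, ?_, ?_⟩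
    · rw [he]; exact key _ hs1 (by omega)
    · rw [hf]; exact key _ (by omega) (by omega)

/-- There is a path with `k` edges starting at `w` whose second vertex is `a`. -/
def HasLeg (G : SimpleGraph V) (w a : V) (k : ℕ) : Prop :=
  ∃ r : ℕ → V, r 0 = w ∧ r 1 = a ∧ (∀ i ≤ k, ∀ j ≤ k, r i = r j → i = j) ∧
    ∀ i < k, G.Adj (r i) (r (i + 1))

theorem HasLeg.lt_card [Finite V] {w a : V} {k : ℕ} (h : HasLeg G w a k) : k < Nat.card V := by
  obtain ⟨r, -, -, hr, -⟩ := h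
  have := Nat.card_le_card_of_injective (fun i : Fin (k + 1) => r i) (fun i j hij =>
    Fin.ext (hr i (by omega) j (by omega) hij))
  simpa using this

theorem exists_hasLeg_of_pathGraph_iso {S : G.Subgraph} (ψ : pathGraph n ≃g S.coe) {w a b : V}
    {i j l : Fin n} (hi : (ψ i : V) = w) (hj : (ψ j : V) = a) (hl : (ψ l : V) = b)
    (hij : (i : ℕ) + 1 = j) (hli : (l : ℕ) + 1 = i) :
    HasLeg G w a (n - 1 - i) ∧ HasLeg G w b i := by
  have inj : ∀ x y : Fin n, (ψ x : V) = ψ y → x = y := fun x y h => ψ.injective (Subtype.ext h)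
  have adj : ∀ x y : Fin n, (x : ℕ) + 1 = y → G.Adj (ψ x : V) (ψ y) := fun x y h =>
    S.adj_sub (ψ.map_adj_iff.2 (pathGraph_adj.2 (Or.inl h)))
  have hin := i.2
  constructor
  -- The value `w` beyond the end of the copy is a filler that is never used.
  · refine ⟨fun t => if h : i + t < n then (ψ ⟨i + t, h⟩ : V) else w, ?_, ?_, ?_, ?_⟩
    · simp [hi]
    · have : (i : ℕ) + 1 < n := by omega
      simp only [this, dite_true]
      rw [← hj]; congr 2; exact Fin.ext hij
    · intro x hx y hy hxy
      beta_reduce at hxy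
      rw [dif_pos (by omega), dif_pos (by omega)] at hxy
      have := congrArg Fin.val (inj _ _ hxy)
      simp only at this
      omega
    · intro x hx
      simp only
      rw [dif_pos (by omega), dif_pos (by omega)]
      exact adj _ _ (by simp only; omega)
  · refine ⟨fun t => ψ ⟨i - t, by omega⟩, by simpa using hi, ?_, ?_, ?_⟩
    · rw [← hl]
      exact congrArg (fun x => (ψ x : V)) (Fin.ext (by change (i : ℕ) - 1 = l; omega))
    · intro x hx y hy hxy
      have := congrArg Fin.val (inj _ _ hxy)
      simp only at this
      omega
    · intro x hx
      exact (adj _ _ (by simp only; omega)).symm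

/-- Two edges `wa`, `wb` that are adjacent in the `P_n`-line graph extend to paths from `w` with
`n - 1` edges in total. -/
theorem exists_hasLeg_of_hLineGraph_adj {w a b : V} (hab : a ≠ b) {e f : G.edgeSet}
    (he : (e : Sym2 V) = s(w, a)) (hf : (f : Sym2 V) = s(w, b))
    (h : (hLineGraph (pathGraph n) G).Adj e f) :
    ∃ k l, k + l + 1 = n ∧ HasLeg G w a k ∧ HasLeg G w b l := by
  obtain ⟨-, S, ⟨ψ⟩, h1, h2⟩ := h
  rw [he] at h1
  rw [hf] at h2
  have h1 : S.Adj w a := h1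
  have h2 : S.Adj w b := h2
  obtain ⟨i, hi⟩ := ψ.surjective ⟨w, h1.fst_mem⟩
  obtain ⟨j, hj⟩ := ψ.surjective ⟨a, h1.snd_mem⟩
  obtain ⟨l, hl⟩ := ψ.surjective ⟨b, h2.snd_mem⟩
  have h3 : (pathGraph n).Adj i j := ψ.map_adj_iff.1 (by rw [hi, hj]; exact h1)
  have h4 : (pathGraph n).Adj i l := ψ.map_adj_iff.1 (by rw [hi, hl]; exact h2)
  have hjl : (j : ℕ) ≠ l := fun h => hab (by
    have : j = l := Fin.ext h
    rw [this, hl] at hj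
    exact (congrArg Subtype.val hj).symm)
  have hi := congrArg Subtype.val hi
  have hj := congrArg Subtype.val hj
  have hl := congrArg Subtype.val hl
  have := i.2
  rw [pathGraph_adj] at h3 h4
  -- Since `a ≠ b`, they lie on opposite sides of `w` in the copy of `P_n`.
  rcases h3 with h3 | h3 <;> rcases h4 with h4 | h4
  · omega
  · obtain ⟨h5, h6⟩ := exists_hasLeg_of_pathGraph_iso ψ hi hj hl h3 h4
    exact ⟨_, _, by omega, h5, h6⟩
  · obtain ⟨h5, h6⟩ := exists_hasLeg_of_pathGraph_iso ψ hi hl hj h4 h3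
    exact ⟨_, _, by omega, h6, h5⟩
  · omega

end PathLineGraph

/-- Isomorphic graphs have isomorphic `H`-line graphs. -/
theorem hLineGraph_congr {V V' : Type u} {W : Type w} (H : SimpleGraph W) {G : SimpleGraph V}
    {G' : SimpleGraph V'} (φ : G ≃g G') : Nonempty (hLineGraph H G ≃g hLineGraph H G') := by
  have mono : ∀ {V V' : Type u} {G : SimpleGraph V} {G' : SimpleGraph V'} (φ : G ≃g G')
      {e f : G.edgeSet}, (hLineGraph H G).Adj e f →
        (hLineGraph H G').Adj (φ.mapEdgeSet e) (φ.mapEdgeSet f) := by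
    intro V V' G G' φ e f h
    obtain ⟨h1, S, ⟨ψ⟩, h2, h3⟩ := h
    refine ⟨?_, S.map φ.toHom, ⟨(φ.toCopy.isoSubgraphMap S).comp ψ⟩, ?_, ?_⟩
    · exact φ.lineGraph.map_adj_iff.2 h1
    · rw [Subgraph.edgeSet_map]
      exact ⟨_, h2, rfl⟩
    · rw [Subgraph.edgeSet_map]
      exact ⟨_, h3, rfl⟩
  refine ⟨⟨φ.mapEdgeSet, fun {e f} => ⟨fun h => ?_, mono φ⟩⟩⟩
  have := mono φ.symm h
  have key : ∀ e, φ.symm.mapEdgeSet (φ.mapEdgeSet e) = e := φ.mapEdgeSet.symm_apply_apply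
  rwa [key, key] at this

/-! ### Transport of finite patterns to the `P_n`-line graph -/

section Embeds

variable {V : Type u} {G : SimpleGraph V} {n : ℕ} {I J : Type*}

/-- The relation `R` on the set `D` is realised injectively by adjacent vertices of `G`. -/
def Embeds (G : SimpleGraph V) (D : Set I) (R : I → I → Prop) : Prop :=
  ∃ u : I → V, Set.InjOn u D ∧ ∀ x ∈ D, ∀ y ∈ D, R x y → G.Adj (u x) (u y)

/-- There is a path with at least `n` vertices in the symmetrisation of `R` on `D` that runs
through `x`, `y`, `z` in this order. -/
def PathThrough (n : ℕ) (D : Set I) (R : I → I → Prop) (x y z : I) : Prop :=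
  ∃ (k : ℕ) (q : ℕ → I), n ≤ k ∧ (∀ i < k, q i ∈ D) ∧ (∀ i < k, ∀ j < k, q i = q j → i = j) ∧
    (∀ i, i + 1 < k → R (q i) (q (i + 1)) ∨ R (q (i + 1)) (q i)) ∧
    ∃ t, t + 2 < k ∧ q t = x ∧ q (t + 1) = y ∧ q (t + 2) = z

theorem Embeds.comap {D : Set I} {R : I → I → Prop} (h : Embeds G D R) {D' : Set J}
    {R' : J → J → Prop} (g : J → I) (hg : ∀ x ∈ D', g x ∈ D) (hinj : Set.InjOn g D')
    (hR : ∀ x ∈ D', ∀ y ∈ D', R' x y → R (g x) (g y) ∨ R (g y) (g x)) : Embeds G D' R' := by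
  obtain ⟨u, hu, hadj⟩ := h
  refine ⟨u ∘ g, hu.comp hinj hg, fun x hx y hy hxy => ?_⟩
  rcases hR x hx y hy hxy with h | h
  · exact hadj _ (hg x hx) _ (hg y hy) h
  · exact (hadj _ (hg y hy) _ (hg x hx) h).symm

/-- A configuration of edges of `R` whose consecutive edges lie on long paths of `R` is realised
in the `P_n`-line graph. -/
theorem Embeds.hLineGraph (hn3 : 3 ≤ n) {D : Set I} {R : I → I → Prop} (h : Embeds G D R)
    {D' : Set J} (hD' : D'.Nonempty) (R' : J → J → Prop) (a b : J → I)
    (ha : ∀ j ∈ D', a j ∈ D) (hb : ∀ j ∈ D', b j ∈ D) (hab : ∀ j ∈ D', R (a j) (b j))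
    (hinj : ∀ i ∈ D', ∀ j ∈ D', s(a i, b i) = s(a j, b j) → i = j)
    (hR' : ∀ i ∈ D', ∀ j ∈ D', R' i j → ∃ x y z, s(a i, b i) = s(x, y) ∧ s(a j, b j) = s(y, z) ∧
      (PathThrough n D R x y z ∨ PathThrough n D R z y x)) :
    Embeds (hLineGraph (pathGraph n) G) D' R' := by
  obtain ⟨u, hu, hadj⟩ := h
  have hex : ∀ j ∈ D', ∃ e : G.edgeSet, (e : Sym2 V) = Sym2.map u s(a j, b j) := fun j hj =>
    ⟨⟨s(u (a j), u (b j)), hadj _ (ha j hj) _ (hb j hj) (hab j hj)⟩, rfl⟩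
  have : Nonempty G.edgeSet := by
    obtain ⟨j, hj⟩ := hD'
    exact ⟨(hex j hj).choose⟩
  choose! e he using hex
  have key : ∀ i ∈ D', ∀ j ∈ D', ∀ x y z, s(a i, b i) = s(x, y) → s(a j, b j) = s(y, z) →
      PathThrough n D R x y z → (SimpleGraph.hLineGraph (pathGraph n) G).Adj (e i) (e j) := by
    intro i hi j hj x y z hxy hyz ⟨k, q, hnk, hqD, hqi, hqa, t, ht, htx, hty, htz⟩
    refine hLineGraph_pathGraph_adj_of_path hn3 hnk (u ∘ q) ?_ ?_ ht ?_ ?_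
    · exact fun i hi j hj h => hqi i hi j hj (hu (hqD i hi) (hqD j hj) h)
    · intro i hi
      rcases hqa i hi with h | h
      · exact hadj _ (hqD _ (by omega)) _ (hqD _ hi) h
      · exact (hadj _ (hqD _ hi) _ (hqD _ (by omega)) h).symm
    · rw [he i hi, hxy, ← htx, ← hty]; rfl
    · rw [he j hj, hyz, ← hty, ← htz]; rfl
  refine ⟨e, fun i hi j hj hij => hinj i hi j hj ?_, fun i hi j hj hij => ?_⟩
  · have h1 : Sym2.map u s(a i, b i) = Sym2.map u s(a j, b j) := by
      rw [← he i hi, ← he j hj, hij]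
    simp only [Sym2.map_mk, Sym2.eq_iff] at h1
    rw [Sym2.eq_iff]
    rcases h1 with ⟨h1, h2⟩ | ⟨h1, h2⟩
    · exact Or.inl ⟨hu (ha i hi) (ha j hj) h1, hu (hb i hi) (hb j hj) h2⟩
    · exact Or.inr ⟨hu (ha i hi) (hb j hj) h1, hu (hb i hi) (ha j hj) h2⟩
  · obtain ⟨x, y, z, h1, h2, h3 | h3⟩ := hR' i hi j hj hij
    · exact key i hi j hj x y z h1 h2 h3
    · exact (key j hj i hi z y x (h2.trans Sym2.eq_swap) (h1.trans Sym2.eq_swap) h3).symm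

end Embeds

/-! ### Lollipops and chorded cycles grow without bound -/

section Growth

variable {V : Type u} {G : SimpleGraph V} {n : ℕ}

/-- `G` contains a cycle with a path attached to it: a path `0, …, N - 1` together with the edge
joining `N - 1` to `p`. -/
def HasLollipop (G : SimpleGraph V) (N p : ℕ) : Prop :=
  Embeds G {i | i < N} fun i j : ℕ => j = i + 1 ∨ i = N - 1 ∧ j = p

/-- `G` contains a cycle of length `N` with a chord joining two vertices at distance two. -/
def HasChordedCycle (G : SimpleGraph V) (N : ℕ) : Prop :=
  Embeds G {i | i < N} fun i j : ℕ => j = i + 1 ∨ i = N - 1 ∧ (j = 0 ∨ j = 1)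

/-- The closing edge of the cycle is adjacent to the last tail edge, so in the line graph the cycle
can be closed through that edge. It becomes one longer and the tail one shorter. -/
theorem HasLollipop.hLineGraph {N p : ℕ} (hn3 : 3 ≤ n) (hN : n ≤ N) (hp : p + 4 ≤ N)
    (h : HasLollipop G N (p + 1)) : HasLollipop (hLineGraph (pathGraph n) G) N p := by
  refine Embeds.hLineGraph hn3 h ⟨0, by simp; omega⟩ _ (fun i => i)
    (fun i => if i + 1 < N then i + 1 else p + 1) ?_ ?_ ?_ ?_ ?_
  · exact fun j hj => hj
  · intro j hj
    simp only [Set.mem_ofPred_eq] at *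
    grind
  · intro j hj
    simp only [Set.mem_ofPred_eq] at *
    grind
  · intro i hi j hj
    simp only [Set.mem_ofPred_eq] at *
    rw [Sym2.eq_iff]
    grind
  · have h1 : ∀ t, t + 2 < N → PathThrough n {i | i < N}
        (fun i j : ℕ => j = i + 1 ∨ i = N - 1 ∧ j = p + 1) t (t + 1) (t + 2) := fun t ht =>
      ⟨N, fun i => i, hN, fun i hi => hi, fun i _ j _ hij => hij, fun i hi => Or.inl (Or.inl rfl),
        t, ht, rfl, rfl, rfl⟩
    -- Up the tail, then around the cycle in the opposite direction: a path through all `N`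
    -- vertices.
    have h2 : ∀ t, (t = p ∨ t = p + 1) → PathThrough n {i | i < N}
        (fun i j : ℕ => j = i + 1 ∨ i = N - 1 ∧ j = p + 1) t
        (if t = p then p + 1 else N - 1) (if t = p then N - 1 else N - 2) := by
      intro t ht
      refine ⟨N, fun i => if i ≤ p + 1 then i else N + p + 1 - i, hN, ?_, ?_, ?_, t, ?_⟩
      · intro i hi
        simp only [Set.mem_ofPred_eq]
        grind
      · intro i hi j hj
        grind
      · intro i hi
        grind
      · grind
    intro i hi j hj hij
    simp only [Set.mem_ofPred_eq] at hi hj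
    by_cases hji : j = i + 1
    · subst hji
      by_cases hi2 : i + 2 < N
      · refine ⟨i, i + 1, i + 2, ?_, ?_, Or.inl (h1 i hi2)⟩ <;> grind
      · refine ⟨N - 2, N - 1, p + 1, ?_, ?_, Or.inr ?_⟩
        · grind
        · grind
        · simpa using h2 (p + 1) (by simp)
    · refine ⟨N - 1, p + 1, p, ?_, ?_, Or.inr ?_⟩
      · grind
      · grind [Sym2.eq_swap]
      · simpa using h2 p (by simp)

/-- The three edges at the attachment vertex `1` form a triangle in the line graph; its side
opposite the tail edge is the chord. -/
theorem HasLollipop.hasChordedCycle_hLineGraph {N : ℕ} (hn3 : 3 ≤ n) (hN : n + 1 ≤ N)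
    (h : HasLollipop G N 1) : HasChordedCycle (SimpleGraph.hLineGraph (pathGraph n) G) N := by
  refine Embeds.hLineGraph hn3 h ⟨0, by simp; omega⟩ _ (fun i => i)
    (fun i => if i + 1 < N then i + 1 else 1) ?_ ?_ ?_ ?_ ?_
  · exact fun j hj => hj
  · intro j hj
    simp only [Set.mem_ofPred_eq] at *
    grind
  · intro j hj
    simp only [Set.mem_ofPred_eq] at *
    grind
  · intro i hi j hj
    simp only [Set.mem_ofPred_eq] at *
    rw [Sym2.eq_iff]
    grind
  · have h1 : ∀ t, t + 2 < N → PathThrough n {i | i < N}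
        (fun i j : ℕ => j = i + 1 ∨ i = N - 1 ∧ j = 1) t (t + 1) (t + 2) := fun t ht =>
      ⟨N, fun i => i, by omega, fun i hi => hi, fun i _ j _ hij => hij,
        fun i hi => Or.inl (Or.inl rfl), t, ht, rfl, rfl, rfl⟩
    have h2 : ∀ t, (t = 0 ∨ t = 1) → PathThrough n {i | i < N}
        (fun i j : ℕ => j = i + 1 ∨ i = N - 1 ∧ j = 1) t
        (if t = 0 then 1 else N - 1) (if t = 0 then N - 1 else N - 2) := by
      intro t ht
      refine ⟨N, fun i => if i ≤ 1 then i else N + 1 - i, by omega, ?_, ?_, ?_, t, ?_⟩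
      · intro i hi
        simp only [Set.mem_ofPred_eq]
        grind
      · intro i hi j hj
        grind
      · intro i hi
        grind
      · grind
    -- This path stays on the cycle and omits the tail vertex `0`, so it has only `N - 1` vertices;
    -- hence the bound `n + 1 ≤ N`.
    have h3 : PathThrough n {i | i < N}
        (fun i j : ℕ => j = i + 1 ∨ i = N - 1 ∧ j = 1) (N - 1) 1 2 := by
      refine ⟨N - 1, fun i => if i = 0 then N - 1 else i, by omega, ?_, ?_, ?_, 0, ?_⟩
      · intro i hi
        simp only [Set.mem_ofPred_eq]
        grind
      · intro i hi j hj
        grind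
      · intro i hi
        grind
      · grind
    intro i hi j hj hij
    simp only [Set.mem_ofPred_eq] at hi hj
    by_cases hji : j = i + 1
    · subst hji
      by_cases hi2 : i + 2 < N
      · refine ⟨i, i + 1, i + 2, ?_, ?_, Or.inl (h1 i hi2)⟩ <;> grind
      · refine ⟨N - 2, N - 1, 1, ?_, ?_, Or.inr ?_⟩
        · grind
        · grind
        · simpa using h2 1 (by simp)
    · by_cases hj0 : j = 0
      · refine ⟨N - 1, 1, 0, ?_, ?_, Or.inr ?_⟩
        · grind
        · grind [Sym2.eq_swap]
        · simpa using h2 0 (by simp)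
      · refine ⟨N - 1, 1, 2, ?_, ?_, Or.inl h3⟩
        · grind
        · grind

/-- The pattern has `N + 1` edges. The chord becomes the end of the tail, and the `N` edges of the
cycle form the new cycle, listed from `{1, 2}` round to `{0, 1}`. -/
theorem HasChordedCycle.hLineGraph {N : ℕ} (hn3 : 3 ≤ n) (hN : n + 1 ≤ N)
    (h : HasChordedCycle G N) :
    HasLollipop (SimpleGraph.hLineGraph (pathGraph n) G) (N + 1) 1 := by
  refine Embeds.hLineGraph hn3 h ⟨0, by simp⟩ _
    (fun i => if i = 0 then N - 1 else if i = N then 0 else i)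
    (fun i => if i + 1 < N then i + 1 else if i + 1 = N then 0 else 1) ?_ ?_ ?_ ?_ ?_
  · intro j hj
    simp only [Set.mem_ofPred_eq] at *
    grind
  · intro j hj
    simp only [Set.mem_ofPred_eq] at *
    grind
  · intro j hj
    simp only [Set.mem_ofPred_eq] at *
    grind
  · intro i hi j hj
    simp only [Set.mem_ofPred_eq] at *
    rw [Sym2.eq_iff]
    grind
  · have h1 : ∀ t, t + 2 < N → PathThrough n {i | i < N}
        (fun i j : ℕ => j = i + 1 ∨ i = N - 1 ∧ (j = 0 ∨ j = 1)) t (t + 1) (t + 2) := fun t ht =>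
      ⟨N, fun i => i, by omega, fun i hi => hi, fun i _ j _ hij => hij,
        fun i hi => Or.inl (Or.inl rfl), t, ht, rfl, rfl, rfl⟩
    have h2 : ∀ t, (t = 0 ∨ t = 1) → PathThrough n {i | i < N}
        (fun i j : ℕ => j = i + 1 ∨ i = N - 1 ∧ (j = 0 ∨ j = 1)) (N - 2 + t)
        (if t = 0 then N - 1 else 0) t := by
      intro t ht
      refine ⟨N, fun i => if i ≤ 1 then N - 2 + i else i - 2, by omega, ?_, ?_, ?_, t, ?_⟩
      · intro i hi
        simp only [Set.mem_ofPred_eq]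
        grind
      · intro i hi j hj
        grind
      · intro i hi
        grind
      · grind
    have h3 : PathThrough n {i | i < N}
        (fun i j : ℕ => j = i + 1 ∨ i = N - 1 ∧ (j = 0 ∨ j = 1)) (N - 1) 1 2 := by
      refine ⟨N - 1, fun i => if i = 0 then N - 1 else i, by omega, ?_, ?_, ?_, 0, ?_⟩
      · intro i hi
        simp only [Set.mem_ofPred_eq]
        grind
      · intro i hi j hj
        grind
      · intro i hi
        grind
      · grind
    intro i hi j hj hij
    simp only [Set.mem_ofPred_eq] at hi hj
    by_cases hji : j = i + 1
    · subst hji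
      by_cases hi0 : i = 0
      · refine ⟨N - 1, 1, 2, ?_, ?_, Or.inl h3⟩ <;> grind
      by_cases hi2 : i + 2 < N
      · refine ⟨i, i + 1, i + 2, ?_, ?_, Or.inl (h1 i hi2)⟩ <;> grind
      by_cases hi3 : i + 2 = N
      · refine ⟨N - 2, N - 1, 0, ?_, ?_, Or.inl (by simpa using h2 0 (by simp))⟩ <;> grind
      · have := h2 1 (by simp)
        rw [show N - 2 + 1 = N - 1 by omega] at this
        refine ⟨N - 1, 0, 1, ?_, ?_, Or.inl (by simpa using this)⟩ <;> grind
    · refine ⟨0, 1, 2, ?_, ?_, Or.inl (h1 0 (by omega))⟩ <;> grind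

/-- `G` contains a configuration that grows under iterating the `P_n`-line graph. -/
def HasGrowingCycle (n : ℕ) (G : SimpleGraph V) : Prop :=
  ∃ N, n + 1 ≤ N ∧ (HasChordedCycle G N ∨ ∃ p, 1 ≤ p ∧ p + 3 ≤ N ∧ HasLollipop G N p)

theorem Embeds.natCard_le [Finite V] {N : ℕ} {R : ℕ → ℕ → Prop} (h : Embeds G {i | i < N} R) :
    N ≤ Nat.card V := by
  obtain ⟨u, hu, -⟩ := h
  have := Nat.card_le_card_of_injective (fun i : Fin N => u i)
    (fun i j hij => Fin.ext (hu i.2 j.2 hij))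
  simpa using this

variable {W : Type w} {H : SimpleGraph W}

instance finite_iterHLineGraph [Finite V] (k : ℕ) : Finite (iterHLineGraph H G k).V := by
  induction k with
  | zero => exact (inferInstance : Finite V)
  | succ k ih =>
    change Finite (iterHLineGraph H G k).graph.edgeSet
    infer_instance

theorem HasLollipop.exists_iterHLineGraph (hn3 : 3 ≤ n) {N k : ℕ} (hN : n + 1 ≤ N)
    (h : HasLollipop (iterHLineGraph (pathGraph n) G k).graph N 1) (m : ℕ) :
    HasLollipop (iterHLineGraph (pathGraph n) G (k + 2 * m)).graph (N + m) 1 := by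
  induction m with
  | zero => exact h
  | succ m ih =>
    exact HasChordedCycle.hLineGraph (N := N + m) hn3 (by omega)
      (ih.hasChordedCycle_hLineGraph hn3 (by omega))

theorem HasLollipop.exists_iterHLineGraph_one (hn3 : 3 ≤ n) {N p k : ℕ} (hN : n + 1 ≤ N)
    (hp : p + 4 ≤ N) (h : HasLollipop (iterHLineGraph (pathGraph n) G k).graph N (p + 1)) :
    ∃ k, HasLollipop (iterHLineGraph (pathGraph n) G k).graph N 1 := by
  induction p generalizing k with
  | zero => exact ⟨k, h⟩
  | succ p ih => exact ih (k := k + 1) (by omega) (h.hLineGraph hn3 (by omega) hp)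

theorem nonempty_iterHLineGraph_iso {N : ℕ}
    (h : Nonempty ((iterHLineGraph H G N).graph ≃g (iterHLineGraph H G (N + 1)).graph)) (m : ℕ) :
    Nonempty ((iterHLineGraph H G N).graph ≃g (iterHLineGraph H G (N + m)).graph) := by
  induction m with
  | zero => exact ⟨Iso.refl⟩
  | succ m ih =>
    obtain ⟨φ⟩ := h
    obtain ⟨ψ⟩ := ih
    obtain ⟨χ⟩ := hLineGraph_congr H ψ
    exact ⟨χ.comp φ⟩

/-- If some iterate contains a growing configuration, then the sequence does not converge. -/
theorem not_memLambda_of_hasGrowingCycle [Finite V] (hn3 : 3 ≤ n) {k : ℕ}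
    (h : HasGrowingCycle n (iterHLineGraph (pathGraph n) G k).graph) : ¬ MemLambda n G := by
  obtain ⟨N, k, hN, hL⟩ : ∃ N k, n + 1 ≤ N ∧
      HasLollipop (iterHLineGraph (pathGraph n) G k).graph N 1 := by
    obtain ⟨N, hN, h | ⟨p, hp1, hpN, h⟩⟩ := h
    · exact ⟨N + 1, k + 1, by omega, h.hLineGraph hn3 hN⟩
    · obtain ⟨p, rfl⟩ : ∃ q, p = q + 1 := ⟨p - 1, by omega⟩
      obtain ⟨k, hk⟩ := h.exists_iterHLineGraph_one hn3 hN (by omega)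
      exact ⟨N, k, hN, hk⟩
  rintro ⟨-, M, hM⟩
  -- So many double steps produce a lollipop larger than the order of the `M`-th term, at an index
  -- not below `M`.
  have h1 := (hL.exists_iterHLineGraph hn3 hN
    (M + Nat.card (iterHLineGraph (pathGraph n) G M).V)).natCard_le
  obtain ⟨m, hm⟩ : ∃ m, k + 2 * (M + Nat.card (iterHLineGraph (pathGraph n) G M).V) = M + m :=
    ⟨k + 2 * (M + Nat.card (iterHLineGraph (pathGraph n) G M).V) - M, by omega⟩
  obtain ⟨φ⟩ := nonempty_iterHLineGraph_iso hM m
  rw [hm, ← Nat.card_congr φ.toEquiv] at h1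
  omega

end Growth

/-! ### Cycles with three equidistant tails -/

section Sun

variable {V : Type u} {G : SimpleGraph V} {n : ℕ}

/-- The pattern of a cycle of length `3 * d` with three equidistant paths attached to it. The
`i`-th strand consists of an attached path with `N i - d` edges, followed by a third of the cycle.
The last vertex of a strand is joined to the first, and if `2 ≤ d` also to the second, vertex of
the next strand that lies on the cycle. -/
def sunRel (N : Fin 3 → ℕ) (d : ℕ) (x y : Fin 3 × ℕ) : Prop :=
  y.1 = x.1 ∧ y.2 = x.2 + 1 ∨
    y.1 = x.1 + 1 ∧ x.2 + 1 = N x.1 ∧ (y.2 + d = N y.1 ∨ y.2 + d = N y.1 + 1)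

/-- `G` contains the pattern `sunRel N d`. -/
def HasSun (G : SimpleGraph V) (N : Fin 3 → ℕ) (d : ℕ) : Prop :=
  Embeds G {x : Fin 3 × ℕ | x.2 < N x.1} (sunRel N d)

/-- A path of `sunRel N d` through two attached paths and two thirds of the cycle. -/
def sunPath (N : Fin 3 → ℕ) (d : ℕ) (i : Fin 3) (t : ℕ) : Fin 3 × ℕ :=
  if t < N i then (i, t) else if t < N i + d then (i + 1, N (i + 1) + t - d - N i)
  else (i + 2, N (i + 2) + N i - t)

theorem fin_three_facts (i : Fin 3) : i + 1 ≠ i ∧ i + 2 ≠ i ∧ i + 1 ≠ i + 2 ∧ i + 1 + 1 = i + 2 ∧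
    i + 2 + 1 = i ∧ i + 2 + 2 = i + 1 ∧ i + 1 + 2 = i := by
  revert i; decide

/-- Replacing the `d` cycle vertices of strand `i + 2` by those of strand `i + 1`, plus the one
vertex where its tail is attached, gives `N i + N (i + 2) + 1` vertices, whatever `d` is. -/
theorem pathThrough_sunPath {N : Fin 3 → ℕ} {d : ℕ} (hd : 1 ≤ d) (hdN : ∀ i, d ≤ N i)
    (hN : ∀ i j, i ≠ j → n ≤ N i + N j + 1) (i : Fin 3) (t : ℕ) (ht : t + 1 < N i + N (i + 2)) :
    PathThrough n {x : Fin 3 × ℕ | x.2 < N x.1} (sunRel N d) (sunPath N d i t)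
      (sunPath N d i (t + 1)) (sunPath N d i (t + 2)) := by
  obtain ⟨f1, f2, f3, f4, f5, f6, f7⟩ := fin_three_facts i
  have d0 := hdN i
  have d1 := hdN (i + 1)
  have d2 := hdN (i + 2)
  refine ⟨N i + N (i + 2) + 1, sunPath N d i, hN _ _ f2.symm, ?_, ?_, ?_, t, by omega,
    rfl, rfl, rfl⟩
  · intro s hs
    simp only [Set.mem_ofPred_eq, sunPath]
    split_ifs <;> simp only <;> omega
  · intro s hs s' hs' h
    simp only [sunPath] at h
    split_ifs at h <;> simp only [Prod.mk.injEq] at h <;> omega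
  · intro s hs
    simp only [sunPath, sunRel]
    split_ifs <;> simp only [f4, f5] <;> first | omega | grind

/-- The edge joining two strands meets both the last tail edge and the first cycle edge of the next
strand. Routing the cycle through that tail edge lengthens each third by one. -/
theorem HasSun.hLineGraph (hn3 : 3 ≤ n) {N : Fin 3 → ℕ} {d : ℕ} (hd : 1 ≤ d)
    (hdN : ∀ i, d < N i) (hN : ∀ i j, i ≠ j → n ≤ N i + N j + 1) (h : HasSun G N d) :
    HasSun (hLineGraph (pathGraph n) G) N (d + 1) := by
  have P := fun i t => pathThrough_sunPath (n := n) hd (fun i => (hdN i).le) hN i t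
  refine Embeds.hLineGraph hn3 h ⟨(0, 0), ?_⟩ _ (fun x => x)
    (fun x => if x.2 + 1 < N x.1 then (x.1, x.2 + 1) else (x.1 + 1, N (x.1 + 1) - d)) ?_ ?_ ?_ ?_ ?_
  · have := hdN 0
    simp only [Set.mem_ofPred_eq]
    omega
  · exact fun j hj => hj
  · rintro ⟨i, j⟩ hj
    simp only [Set.mem_ofPred_eq] at *
    have := hdN (i + 1)
    split_ifs
    · assumption
    · simp only; omega
  · rintro ⟨i, j⟩ hj
    simp only [Set.mem_ofPred_eq] at *
    have := hdN (i + 1)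
    split_ifs
    · exact Or.inl ⟨rfl, rfl⟩
    · exact Or.inr ⟨rfl, by simp only; omega, by simp only; omega⟩
  · rintro ⟨i, j⟩ hi ⟨i', j'⟩ hj
    simp only [Set.mem_ofPred_eq] at *
    rw [Sym2.eq_iff]
    have := hdN (i + 1)
    obtain ⟨f1, f2, f3, f4, f5, f6, f7⟩ := fin_three_facts i
    split_ifs <;> simp only [Prod.mk.injEq] <;> omega
  · rintro ⟨i, j⟩ hi ⟨i', j'⟩ hj hij
    simp only [Set.mem_ofPred_eq] at hi hj
    obtain ⟨f1, f2, f3, f4, f5, f6, f7⟩ := fin_three_facts i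
    have d0 := hdN i
    have d1 := hdN (i + 1)
    have d2 := hdN (i + 2)
    rcases hij with ⟨h1, h2⟩ | ⟨h1, h2, h3⟩
    · simp only at h1 h2
      subst h1 h2
      refine ⟨_, _, _, ?_, ?_, Or.inl (P i' j (by omega))⟩
      · simp only [sunPath]; grind
      · simp only [sunPath]; grind
    · simp only at h1 h2 h3
      subst h1
      rcases h3 with h3 | h3
      -- The turn from the cycle into the tail of strand `i + 1` occurs on the path that starts in
      -- strand `i + 2`.
      · have := P (i + 2) (N (i + 2) + d - 1) (by rw [f6]; omega)
        refine ⟨_, _, _, ?_, ?_, Or.inl this⟩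
        · simp only [sunPath]; grind
        · simp only [sunPath]; grind
      · refine ⟨_, _, _, ?_, ?_, Or.inl (P i j (by omega))⟩
        · simp only [sunPath]; grind
        · simp only [sunPath]; grind

end Sun

/-! ### From suns to growing configurations -/

section SunGrowth

variable {V : Type u} {G : SimpleGraph V} {n : ℕ}

/-- One attached path of a sun followed by the whole cycle. -/
def sunLollipop (N : Fin 3 → ℕ) (d : ℕ) (x : Fin 3) (t : ℕ) : Fin 3 × ℕ :=
  if t < N x then (x, t) else if t < N x + d then (x + 1, N (x + 1) + t - d - N x)
  else (x + 2, N (x + 2) + t - 2 * d - N x)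

theorem sunLollipop_lt {N : Fin 3 → ℕ} {d : ℕ} (hdN : ∀ i, d ≤ N i) (x : Fin 3) (t : ℕ)
    (ht : t < N x + 2 * d) : (sunLollipop N d x t).2 < N (sunLollipop N d x t).1 := by
  have d1 := hdN (x + 1)
  have d2 := hdN (x + 2)
  simp only [sunLollipop]
  split_ifs <;> simp only <;> omega

theorem injOn_sunLollipop {N : Fin 3 → ℕ} {d : ℕ} (hdN : ∀ i, d ≤ N i) (x : Fin 3) :
    Set.InjOn (sunLollipop N d x) {t | t < N x + 2 * d} := by
  obtain ⟨f1, f2, f3, f4, f5, f6, f7⟩ := fin_three_facts x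
  have d1 := hdN (x + 1)
  have d2 := hdN (x + 2)
  intro s hs s' hs' h
  simp only [Set.mem_ofPred_eq] at hs hs'
  simp only [sunLollipop] at h
  split_ifs at h <;> simp only [Prod.mk.injEq] at h <;> omega

theorem HasSun.hasLollipop {N : Fin 3 → ℕ} {d : ℕ} (hd : 1 ≤ d) (hdN : ∀ i, d ≤ N i)
    (h : HasSun G N d) (x : Fin 3) : HasLollipop G (N x + 2 * d) (N x - d) := by
  obtain ⟨f1, f2, f3, f4, f5, f6, f7⟩ := fin_three_facts x
  have d0 := hdN x
  have d1 := hdN (x + 1)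
  have d2 := hdN (x + 2)
  refine Embeds.comap h (sunLollipop N d x) (sunLollipop_lt hdN x) (injOn_sunLollipop hdN x) ?_
  intro s hs t ht hst
  left
  simp only [Set.mem_ofPred_eq] at hs ht
  simp only [sunLollipop, sunRel]
  grind

/-- With no tail on strand `x`, the round trip is the whole cycle, and the second join from the last
strand back to strand `x` is the chord; it exists because `2 ≤ d`. -/
theorem HasSun.hasChordedCycle {N : Fin 3 → ℕ} {d : ℕ} (hd : 2 ≤ d) (hdN : ∀ i, d ≤ N i)
    (h : HasSun G N d) (x : Fin 3) (hx : N x = d) : HasChordedCycle G (3 * d) := by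
  obtain ⟨f1, f2, f3, f4, f5, f6, f7⟩ := fin_three_facts x
  have d0 := hdN x
  have d1 := hdN (x + 1)
  have d2 := hdN (x + 2)
  have h3 : 3 * d = N x + 2 * d := by omega
  rw [h3]
  refine Embeds.comap h (sunLollipop N d x) (sunLollipop_lt hdN x) (injOn_sunLollipop hdN x) ?_
  intro s hs t ht hst
  left
  simp only [Set.mem_ofPred_eq] at hs ht
  simp only [sunLollipop, sunRel]
  grind

/-- The pattern of a triangle `X - 1, X, X + 1` with a path attached to `X - 1` and an edge
attached to `X + 1`. -/
def bullRel (X i j : ℕ) : Prop := j = i + 1 ∨ i = X + 1 ∧ j = X - 1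

/-- One tail is kept whole and another is cut down to a single edge; the trivial strand `m` supplies
the triangle vertex without a tail. -/
theorem HasSun.embeds_bullRel {N : Fin 3 → ℕ} (h : HasSun G N 1) {m : Fin 3} (hm : N m = 1)
    (h1 : 2 ≤ N (m + 1)) (h2 : 2 ≤ N (m + 2)) :
    Embeds G {i | i < N (m + 1) + 3} (bullRel (N (m + 1))) := by
  obtain ⟨f1, f2, f3, f4, f5, f6, f7⟩ := fin_three_facts m
  refine Embeds.comap h (fun t => if t < N (m + 1) then (m + 1, t) else
    if t = N (m + 1) then (m, 0) else (m + 2, N (m + 2) + N (m + 1) - t)) ?_ ?_ ?_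
  · intro t ht
    simp only [Set.mem_ofPred_eq] at *
    grind
  · intro s hs t ht hst
    simp only [Set.mem_ofPred_eq] at *
    grind
  · intro s hs t ht hst
    simp only [Set.mem_ofPred_eq, bullRel, sunRel] at *
    grind

/-- All `X + 3` edges are used. The triangle edge `{X - 1, X + 1}` closes the path of the others at
the tail edge `{X - 2, X - 1}`, leaving a tail of `X - 2` edges. If `X = 2`, no tail remains, and `n
= 4` makes a chord available. -/
theorem hasGrowingCycle_hLineGraph_of_bullRel (hn : 4 ≤ n) {X : ℕ} (hX : n ≤ X + 2)
    (h : Embeds G {i | i < X + 3} (bullRel X)) :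
    HasGrowingCycle n (hLineGraph (pathGraph n) G) := by
  have key : ∀ R' : ℕ → ℕ → Prop, (∀ i < X + 3, ∀ j < X + 3, R' i j →
      j = i + 1 ∨ i = X + 2 ∧ j = X - 2 ∨ i = X + 2 ∧ j = X - 1 ∧ n = 4 ∧ X = 2) →
      Embeds (hLineGraph (pathGraph n) G) {i | i < X + 3} R' := by
    intro R' hR'
    refine Embeds.hLineGraph (by omega) h ⟨0, by simp⟩ _ (fun i => if i = X + 2 then X + 1 else i)
      (fun i => if i = X + 2 then X - 1 else i + 1) ?_ ?_ ?_ ?_ ?_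
    · intro j hj
      simp only [Set.mem_ofPred_eq] at *
      grind
    · intro j hj
      simp only [Set.mem_ofPred_eq] at *
      grind
    · intro j hj
      simp only [Set.mem_ofPred_eq, bullRel] at *
      grind
    · intro i hi j hj
      simp only [Set.mem_ofPred_eq] at *
      rw [Sym2.eq_iff]
      grind
    · have h1 : ∀ t, t + 2 < X + 3 →
          PathThrough n {i | i < X + 3} (bullRel X) t (t + 1) (t + 2) := fun t ht =>
        ⟨X + 3, fun i => i, by omega, fun i hi => hi, fun i _ j _ hij => hij,
          fun i hi => Or.inl (Or.inl rfl), t, ht, rfl, rfl, rfl⟩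
      have h2 : ∀ t, (t = X - 2 ∨ t = X - 1) → PathThrough n {i | i < X + 3} (bullRel X) t
          (if t = X - 1 then X + 1 else X - 1) (if t = X - 1 then X + 2 else X + 1) := by
        intro t ht
        refine ⟨X + 2, fun i => if i < X then i else i + 1, by omega, ?_, ?_, ?_, t, ?_⟩
        · intro i hi
          simp only [Set.mem_ofPred_eq]
          grind
        · intro i hi j hj
          grind
        · intro i hi
          simp only [bullRel]
          grind
        · grind
      have h3 : n = 4 → X = 2 → PathThrough n {i | i < X + 3} (bullRel X) 3 1 2 := by
        rintro rfl rfl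
        refine ⟨4, fun i => if i < 2 then 4 - i else i - 1, le_rfl, ?_, ?_, ?_, 1, ?_⟩
        · intro i hi
          simp only [Set.mem_ofPred_eq]
          grind
        · intro i hi j hj
          grind
        · intro i hi
          simp only [bullRel]
          grind
        · grind
      intro i hi j hj hij
      have hij := hR' i hi j hj hij
      simp only [Set.mem_ofPred_eq] at hi hj
      rcases hij with rfl | ⟨rfl, rfl⟩ | ⟨rfl, rfl, h4, rfl⟩
      · by_cases hi2 : i + 2 < X + 3
        · refine ⟨i, i + 1, i + 2, ?_, ?_, Or.inl (h1 i (by omega))⟩ <;> grind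
        · have := h2 (X - 1) (by simp)
          simp only [if_true] at this
          refine ⟨X + 2, X + 1, X - 1, ?_, ?_, Or.inr this⟩ <;> grind
      · have := h2 (X - 2) (by simp)
        rw [if_neg (by omega), if_neg (by omega)] at this
        refine ⟨X + 1, X - 1, X - 2, ?_, ?_, Or.inr this⟩
        · grind
        · grind [Sym2.eq_swap]
      · refine ⟨3, 1, 2, ?_, ?_, Or.inl (h3 h4 rfl)⟩ <;> grind
  refine ⟨X + 3, by omega, ?_⟩
  by_cases hX2 : X = 2
  · left
    refine key _ fun i hi j hj hij => ?_
    omega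
  · refine Or.inr ⟨X - 2, by omega, by omega, key _ fun i hi j hj hij => ?_⟩
    omega

theorem HasSun.exists_iterHLineGraph (hn3 : 3 ≤ n) {N : Fin 3 → ℕ}
    (hN : ∀ i j, i ≠ j → n ≤ N i + N j + 1) {k : ℕ}
    (h : HasSun (iterHLineGraph (pathGraph n) G k).graph N 1) (d : ℕ) (hd : ∀ i, d + 1 ≤ N i) :
    HasSun (iterHLineGraph (pathGraph n) G (k + d)).graph N (d + 1) := by
  induction d with
  | zero => exact h
  | succ d ih =>
    exact HasSun.hLineGraph hn3 (by omega) (fun i => hd i) hN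
      (ih fun i => (Nat.le_succ _).trans (hd i))

/-- A triangle with three attached paths that are pairwise long enough leads to a growing
configuration. -/
theorem HasSun.exists_hasGrowingCycle (hn : 4 ≤ n) {N : Fin 3 → ℕ} (hN1 : ∀ i, 1 ≤ N i)
    (hN : ∀ i j, i ≠ j → n ≤ N i + N j + 1) {k : ℕ}
    (h : HasSun (iterHLineGraph (pathGraph n) G k).graph N 1) :
    ∃ k, HasGrowingCycle n (iterHLineGraph (pathGraph n) G k).graph := by
  obtain ⟨m, hm⟩ := Finite.exists_min N
  obtain ⟨f1, f2, f3, f4, f5, f6, f7⟩ := fin_three_facts m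
  have e1 := hN _ _ f1
  have e2 := hN _ _ f2
  have e3 := hN1 m
  rcases Nat.lt_or_ge (N m) 2 with hc | hc
  · exact ⟨k + 1, hasGrowingCycle_hLineGraph_of_bullRel hn (by omega)
      (h.embeds_bullRel (m := m) (by omega) (by omega) (by omega))⟩
  · have hs := h.exists_iterHLineGraph (by omega) hN (N m - 1) (fun i => by have := hm i; omega)
    rw [show N m - 1 + 1 = N m by omega] at hs
    refine ⟨k + (N m - 1), ?_⟩
    -- The shortest tail is now used up. A longer strand still has a tail and yields a lollipop; if
    -- all strands are equal, only the cycle of length `3 * N m` with its chords remains.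
    by_cases hx : ∃ x, N m < N x
    · obtain ⟨x, hx⟩ := hx
      have hxm := hN x m (by rintro rfl; omega)
      exact ⟨_, by omega, Or.inr ⟨_, by omega, by omega, hs.hasLollipop (by omega) hm x⟩⟩
    · push Not at hx
      have := hx (m + 1)
      exact ⟨_, by omega, Or.inl (hs.hasChordedCycle hc hm m rfl)⟩

end SunGrowth

/-! ### Spiders at a vertex on no cycle -/

section Spider

variable {V : Type u} {G : SimpleGraph V} {n : ℕ}

/-- Three paths starting at a common vertex and otherwise disjoint become a triangle with three
attached paths in the `P_n`-line graph if any two of them have at least `n - 1` edges in total. -/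
theorem hasSun_hLineGraph_of_spider (hn3 : 3 ≤ n) {N : Fin 3 → ℕ} {u : Fin 3 → ℕ → V} {w : V}
    (hw : ∀ i, u i 0 = w) (hadj : ∀ i, ∀ j < N i, G.Adj (u i j) (u i (j + 1)))
    (hinj : ∀ i i' j j', j ≤ N i → j' ≤ N i' → u i j = u i' j' → j = j' ∧ (i = i' ∨ j = 0))
    (hN1 : ∀ i, 1 ≤ N i) (hN : ∀ i j, i ≠ j → n ≤ N i + N j + 1) :
    HasSun (hLineGraph (pathGraph n) G) N 1 := by
  -- Edges are numbered from the far end of a leg towards `w`, so the last one of each strand is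
  -- incident with `w` and these three form the triangle.
  have hex : ∀ x : Fin 3 × ℕ, x.2 < N x.1 → ∃ e : G.edgeSet,
      (e : Sym2 V) = s(u x.1 (N x.1 - x.2), u x.1 (N x.1 - (x.2 + 1))) := by
    rintro ⟨i, j⟩ hj
    simp only at hj ⊢
    have := hadj i (N i - (j + 1)) (by omega)
    rw [show N i - (j + 1) + 1 = N i - j by omega] at this
    exact ⟨⟨_, this.symm⟩, rfl⟩
  have : Nonempty G.edgeSet := ⟨(hex (0, 0) (hN1 0)).choose⟩
  choose! e he using hex
  have key : ∀ i i', i ≠ i' → ∀ t, t + 1 < N i + N i' → ∀ e f : G.edgeSet,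
      (e : Sym2 V) = s(if t ≤ N i then u i (N i - t) else u i' (t - N i),
        if t + 1 ≤ N i then u i (N i - (t + 1)) else u i' (t + 1 - N i)) →
      (f : Sym2 V) = s(if t + 1 ≤ N i then u i (N i - (t + 1)) else u i' (t + 1 - N i),
        if t + 2 ≤ N i then u i (N i - (t + 2)) else u i' (t + 2 - N i)) →
      (hLineGraph (pathGraph n) G).Adj e f := by
    intro i i' hi t ht e f he hf
    refine hLineGraph_pathGraph_adj_of_path (k := N i + N i' + 1) hn3 (hN i i' hi)
      (fun t => if t ≤ N i then u i (N i - t) else u i' (t - N i)) ?_ ?_ (t := t) (by omega) he hf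
    · intro s hs s' hs' h
      beta_reduce at h
      split_ifs at h
      · have := (hinj _ _ _ _ (by omega) (by omega) h).1
        omega
      · have := hinj _ _ _ _ (by omega) (by omega) h
        have := this.2.resolve_left hi
        omega
      · have := hinj _ _ _ _ (by omega) (by omega) h
        have := this.2.resolve_left hi.symm
        omega
      · have := (hinj _ _ _ _ (by omega) (by omega) h).1
        omega
    · intro s hs
      rcases lt_trichotomy s (N i) with h | h | h
      · simp only [h.le, Nat.succ_le_iff.2 h, if_true]
        have := hadj i (N i - (s + 1)) (by omega)
        rw [show N i - (s + 1) + 1 = N i - s by omega] at this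
        exact this.symm
      · subst h
        have := hadj i' 0 (hN1 i')
        rw [hw i'] at this
        simpa [hw i] using this
      · simp only [h.not_ge, (h.trans (Nat.lt_succ_self s)).not_ge, if_false]
        have := hadj i' (s - N i) (by omega)
        rwa [show s - N i + 1 = s + 1 - N i by omega] at this
  refine ⟨e, ?_, ?_⟩
  · rintro ⟨i, j⟩ hj ⟨i', j'⟩ hj' h
    simp only [Set.mem_ofPred_eq] at hj hj'
    have h1 := (he _ hj).symm.trans ((congrArg Subtype.val h).trans (he _ hj'))
    simp only [Sym2.eq_iff] at h1
    rcases h1 with ⟨h1, h2⟩ | ⟨h1, h2⟩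
    · have h3 := hinj _ _ _ _ (by omega) (by omega) h1
      have h4 : i = i' := h3.2.resolve_right (by omega)
      subst h4
      exact Prod.ext rfl (by simp only; omega)
    · have h3 := (hinj _ _ _ _ (by omega) (by omega) h1).1
      have h4 := (hinj _ _ _ _ (by omega) (by omega) h2).1
      omega
  · rintro ⟨i, j⟩ hj ⟨i', j'⟩ hj' h
    obtain ⟨f1, -⟩ := fin_three_facts i
    have he1 := he _ hj
    have he2 := he _ hj'
    simp only [Set.mem_ofPred_eq] at hj hj' he1 he2
    have d1 := hN1 (i + 1)
    rcases h with ⟨h1, h2⟩ | ⟨h1, h2, h3⟩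
    · simp only at h1 h2
      subst h1 h2
      refine key i' (i' + 1) f1.symm j (by omega) _ _ ?_ ?_
      · rw [he1, if_pos (by omega), if_pos (by omega)]
      · rw [he2, if_pos (by omega), if_pos (by omega)]
    · simp only at h1 h2 h3
      subst h1
      refine key i (i + 1) f1.symm j (by omega) _ _ ?_ ?_
      · rw [he1, if_pos (by omega), if_pos (by omega)]
      · rw [he2, if_pos (by omega), if_neg (by omega), Sym2.eq_swap,
          show N (i + 1) - (j' + 1) = 0 by omega, show N (i + 1) - j' = 1 by omega,
          show N i - (j + 1) = 0 by omega, show j + 2 - N i = 1 by omega, hw, hw]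

theorem isBridge_of_notMem_cycle {w a : V}
    (hw : ∀ (x : V) (c : G.Walk x x), c.IsCycle → w ∉ c.support) (h : G.Adj w a) :
    G.IsBridge s(w, a) :=
  (isBridge_iff_forall_cycle_notMem (G.mem_edgeSet.2 h)).2 fun _ c hc hmem =>
    hw _ c hc (c.fst_mem_support_of_mem_edges hmem)

theorem reachable_deleteEdges_of_path {r : ℕ → V} {k : ℕ}
    (hinj : ∀ i ≤ k, ∀ j ≤ k, r i = r j → i = j) (hadj : ∀ i < k, G.Adj (r i) (r (i + 1))) (a : V)
    {j : ℕ} (hj : j < k) : (G.deleteEdges {s(r 0, a)}).Reachable (r 1) (r (j + 1)) := by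
  induction j with
  | zero => exact Reachable.refl _
  | succ j ih =>
    refine (ih (by omega)).trans (Adj.reachable ?_)
    rw [deleteEdges_adj]
    refine ⟨hadj _ hj, fun h => ?_⟩
    rcases Sym2.eq_iff.1 (Set.mem_singleton_iff.1 h) with ⟨h, -⟩ | ⟨-, h⟩ <;>
    · have := hinj _ (by omega) _ (by omega) h
      omega

/-- Paths that leave a vertex lying on no cycle along different edges do not meet again. -/
theorem eq_zero_of_path_eq_path {w : V}
    (hw : ∀ (x : V) (c : G.Walk x x), c.IsCycle → w ∉ c.support) {r r' : ℕ → V} {k k' : ℕ}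
    (h0 : r 0 = w) (h0' : r' 0 = w) (h1 : r 1 ≠ r' 1)
    (hinj : ∀ i ≤ k, ∀ j ≤ k, r i = r j → i = j) (hadj : ∀ i < k, G.Adj (r i) (r (i + 1)))
    (hinj' : ∀ i ≤ k', ∀ j ≤ k', r' i = r' j → i = j)
    (hadj' : ∀ i < k', G.Adj (r' i) (r' (i + 1))) {j j' : ℕ} (hj : j ≤ k) (hj' : j' ≤ k')
    (h : r j = r' j') : j = 0 ∧ j' = 0 := by
  rcases Nat.eq_zero_or_pos j with rfl | hj0
  · exact ⟨rfl, hinj' _ hj' _ (Nat.zero_le _) (by rw [← h, h0, h0'])⟩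
  rcases Nat.eq_zero_or_pos j' with rfl | hj0'
  · exact ⟨hinj _ hj _ (Nat.zero_le _) (by rw [h, h0, h0']), rfl⟩
  exfalso
  obtain ⟨j, rfl⟩ : ∃ i, j = i + 1 := ⟨j - 1, by omega⟩
  obtain ⟨j', rfl⟩ : ∃ i, j' = i + 1 := ⟨j' - 1, by omega⟩
  have hwa := hadj 0 (by omega)
  have hwb := hadj' 0 (by omega)
  have hbr := isBridge_iff.1 (isBridge_of_notMem_cycle (h0 ▸ hw) hwa)
  have e1 := reachable_deleteEdges_of_path hinj hadj (r 1) (Nat.lt_of_succ_le hj)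
  have e2 := reachable_deleteEdges_of_path hinj' hadj' (r 1) (Nat.lt_of_succ_le hj')
  rw [h0'] at e2 hwb
  rw [h0] at hbr e1
  rw [h] at e1
  -- A meeting point would connect `w` to `r 1` through `r' 1`, avoiding the bridge `{w, r 1}`.
  refine hbr (Reachable.trans (Adj.reachable ?_) (e2.trans e1.symm))
  rw [deleteEdges_adj]
  refine ⟨hwb, fun h => ?_⟩
  rcases Sym2.eq_iff.1 (Set.mem_singleton_iff.1 h) with ⟨-, h⟩ | ⟨-, h⟩
  · exact h1 h.symm
  · exact hwb.ne h.symm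

/-- A graph whose sequence converges has no vertex off the cycles from which three paths start
along different edges such that any two of them have at least `n - 1` edges in total. -/
theorem not_memLambda_of_hasLeg [Finite V] (hn : 4 ≤ n) {w : V}
    (hw : ∀ (x : V) (c : G.Walk x x), c.IsCycle → w ∉ c.support) {a : Fin 3 → V}
    (ha : Function.Injective a) {N : Fin 3 → ℕ} (hN1 : ∀ i, 1 ≤ N i)
    (hN : ∀ i j, i ≠ j → n ≤ N i + N j + 1) (hleg : ∀ i, HasLeg G w (a i) (N i)) :
    ¬ MemLambda n G := by
  choose u hu0 hu1 hinj hadj using hleg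
  have hsun : HasSun (hLineGraph (pathGraph n) G) N 1 := by
    refine hasSun_hLineGraph_of_spider (by omega) hu0 hadj ?_ hN1 hN
    intro i i' j j' hj hj' h
    by_cases hii : i = i'
    · subst hii
      exact ⟨hinj i _ hj _ hj' h, Or.inl rfl⟩
    · have := eq_zero_of_path_eq_path hw (hu0 i) (hu0 i')
        (by rw [hu1, hu1]; exact fun h => hii (ha h)) (hinj i) (hadj i) (hinj i') (hadj i') hj hj' h
      exact ⟨this.1.trans this.2.symm, Or.inr this.1⟩
  obtain ⟨k, hk⟩ := HasSun.exists_hasGrowingCycle (G := G) (k := 1) hn hN1 hN hsun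
  exact not_memLambda_of_hasGrowingCycle (by omega) hk

end Spider

/-! ### Cycles of the line graph through edges at a vertex on no cycle -/

section CycleAtVertex

variable {V : Type u} {W : Type w} {H : SimpleGraph W} {G : SimpleGraph V} {n : ℕ}

theorem reachable_deleteEdges_of_mem_edge {e f : G.edgeSet} (hef : e ≠ f) {x y : V}
    (hx : x ∈ (e : Sym2 V)) (hy : y ∈ (e : Sym2 V)) :
    (G.deleteEdges {(f : Sym2 V)}).Reachable x y := by
  by_cases hxy : x = y
  · rw [hxy]
  · have he := (Sym2.mem_and_mem_iff hxy).1 ⟨hx, hy⟩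
    refine Adj.reachable (deleteEdges_adj.2 ⟨?_, fun h => hef (Subtype.ext ?_)⟩)
    · rw [← mem_edgeSet, ← he]; exact e.2
    · rw [he]; exact h

/-- A cycle of `HL(G)` with two successive vertices incident with `w`, where `w` lies on no cycle
of `G`, consists of edges incident with `w`. -/
theorem mem_of_mem_support_of_isCycle {w : V}
    (hw : ∀ (x : V) (c : G.Walk x x), c.IsCycle → w ∉ c.support) {e : G.edgeSet}
    {c : (hLineGraph H G).Walk e e} (hc : c.IsCycle) (he : w ∈ (e : Sym2 V))
    (he1 : w ∈ (c.snd : Sym2 V)) {f : G.edgeSet} (hf : f ∈ c.support) : w ∈ (f : Sym2 V) := by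
  obtain ⟨i, rfl, hi⟩ := Walk.mem_support_iff_exists_getVert.1 hf
  clear hf
  induction i with
  | zero => simpa using he
  | succ i ih =>
    rcases Nat.eq_zero_or_pos i with rfl | hi0
    · exact he1
    by_contra hcon
    have ih := ih (by omega)
    have hadj := (c.adj_getVert_succ (show i < c.length by omega)).1
    obtain ⟨-, v, hv, hv'⟩ := lineGraph_adj_iff_exists.1 hadj
    have hvw : w ≠ v := by rintro rfl; exact hcon hv'
    have hedge := (Sym2.mem_and_mem_iff hvw).1 ⟨ih, hv⟩
    have hGadj : G.Adj w v := by rw [← mem_edgeSet, ← hedge]; exact (c.getVert i).2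
    have hbr := isBridge_iff.1 (isBridge_of_notMem_cycle hw hGadj)
    -- As `i` is positive, the edge `{w, v}` is not revisited even when the cycle closes; so the
    -- rest of the cycle would connect `v` to `w` without this bridge.
    have hne : ∀ j, i < j → j ≤ c.length → c.getVert j ≠ c.getVert i := by
      intro j h1 h2 h
      have := hc.getVert_injOn (show 1 ≤ j ∧ j ≤ c.length by omega)
        (show 1 ≤ i ∧ i ≤ c.length by omega) h
      omega
    have hreach : ∀ j, i + 1 + j ≤ c.length → ∀ x ∈ (c.getVert (i + 1 + j) : Sym2 V),
        (G.deleteEdges {s(w, v)}).Reachable v x := by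
      intro j
      induction j with
      | zero =>
        intro hj x hx
        rw [← hedge]
        exact reachable_deleteEdges_of_mem_edge (hne _ (by omega) hj) hv' hx
      | succ j ihj =>
        intro hj x hx
        have hadj := (c.adj_getVert_succ (show i + 1 + j < c.length by omega)).1
        obtain ⟨-, y, hy, hy'⟩ := lineGraph_adj_iff_exists.1 hadj
        refine (ihj (by omega) y hy).trans ?_
        rw [← hedge]
        exact reachable_deleteEdges_of_mem_edge (hne _ (by omega) hj) hy' hx
    have := hreach (c.length - (i + 1)) (by omega) w
      (by rw [show i + 1 + (c.length - (i + 1)) = c.length by omega, Walk.getVert_length]; exact he)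
    exact hbr this.symm

theorem hasLeg_one {w a : V} (h : G.Adj w a) : HasLeg G w a 1 := by
  refine ⟨fun t => if t = 0 then w else a, by simp, by simp, ?_, ?_⟩
  · have := h.ne
    intro i hi j hj hij
    simp only at hij
    split_ifs at hij <;> first | omega | (exact absurd hij this) | (exact absurd hij.symm this)
  · intro i hi
    obtain rfl : i = 0 := by omega
    simpa using h

theorem injective_vec_three {α : Type*} {x y z : α} (hxy : x ≠ y) (hxz : x ≠ z) (hyz : y ≠ z) :
    Function.Injective ![x, y, z] := by
  intro i j h
  fin_cases i <;> fin_cases j <;> simp_all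

/-- If all vertices of a cycle of the `P_n`-line graph are edges incident with a vertex that lies
on no cycle of `G`, then the sequence of `G` does not converge. -/
theorem not_memLambda_of_isCycle_at_vertex [Finite V] (hn : 4 ≤ n) {w : V}
    (hw : ∀ (x : V) (c : G.Walk x x), c.IsCycle → w ∉ c.support) {e : G.edgeSet}
    {c : (hLineGraph (pathGraph n) G).Walk e e} (hc : c.IsCycle)
    (hcw : ∀ f ∈ c.support, w ∈ (f : Sym2 V)) : ¬ MemLambda n G := by
  classical
  have hnbr : ∀ f ∈ c.support, ∃ a, (f : Sym2 V) = s(w, a) := fun f hf => hcw f hf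
  have : Nonempty V := ⟨w⟩
  choose! a ha using hnbr
  have hGadj : ∀ f ∈ c.support, G.Adj w (a f) := fun f hf => by
    rw [← mem_edgeSet, ← ha f hf]; exact f.2
  let h : G.edgeSet → ℕ := fun f => Nat.findGreatest (HasLeg G w (a f)) (Nat.card V)
  have hle : ∀ f k, HasLeg G w (a f) k → k ≤ h f := fun f k hk =>
    Nat.le_findGreatest hk.lt_card.le hk
  have hh1 : ∀ f ∈ c.support, 1 ≤ h f := fun f hf => hle f 1 (hasLeg_one (hGadj f hf))
  have hleg : ∀ f ∈ c.support, HasLeg G w (a f) (h f) := fun f hf =>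
    Nat.findGreatest_spec (hasLeg_one (hGadj f hf)).lt_card.le (hasLeg_one (hGadj f hf))
  have hinj : ∀ f ∈ c.support, ∀ g ∈ c.support, a f = a g → f = g := fun f hf g hg hfg =>
    Subtype.ext (by rw [ha f hf, ha g hg, hfg])
  have hsum : ∀ f ∈ c.support, ∀ g ∈ c.support, (hLineGraph (pathGraph n) G).Adj f g →
      n ≤ h f + h g + 1 := by
    intro f hf g hg hfg
    obtain ⟨k, l, hkl, hk, hl⟩ := exists_hasLeg_of_hLineGraph_adj
      (fun h => hfg.ne (hinj f hf g hg h)) (ha f hf) (ha g hg) hfg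
    have := hle f k hk
    have := hle g l hl
    omega
  -- With `m` shortest, the lengths at its two neighbours also add up to at least `n - 1`, although
  -- these need not be adjacent.
  obtain ⟨m, hm, hmin⟩ := Set.exists_min_image {f | f ∈ c.support} h (Set.toFinite _)
    ⟨e, c.start_mem_support⟩
  have hm : m ∈ c.support := hm
  have hc' := hc.rotate hm
  have hsupp : ∀ f, f ∈ (c.rotate m hm).support → f ∈ c.support := fun f hf =>
    (Walk.mem_support_rotate_iff ..).1 hf
  set c' := c.rotate m hm
  have hf : c'.snd ∈ c.support := hsupp _ (c'.getVert_mem_support _)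
  have hg : c'.penultimate ∈ c.support := hsupp _ (c'.getVert_mem_support _)
  have hmf := c'.adj_snd hc'.not_nil
  have hgm := c'.adj_penultimate hc'.not_nil
  have hfg := hc'.snd_ne_penultimate
  have s1 := hsum _ hm _ hf hmf
  have s2 := hsum _ hg _ hm hgm
  have m1 := hmin _ hf
  have m2 := hmin _ hg
  have hmem : ∀ i, ![m, c'.snd, c'.penultimate] i ∈ c.support := by
    intro i; fin_cases i <;> assumption
  refine not_memLambda_of_hasLeg hn hw (a := fun i => a (![m, c'.snd, c'.penultimate] i))
    (N := fun i => h (![m, c'.snd, c'.penultimate] i)) ?_ (fun i => hh1 _ (hmem i)) ?_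
    (fun i => hleg _ (hmem i))
  · exact fun i j hij =>
      injective_vec_three hmf.ne hgm.ne.symm hfg (hinj _ (hmem i) _ (hmem j) hij)
  · intro i j hij
    fin_cases i <;> fin_cases j <;> simp at hij ⊢ <;> omega

end CycleAtVertex

end SimpleGraph

theorem mainTheorem5 {V : Type*} [Finite V] (n : ℕ) (hn : 4 ≤ n) (G : SimpleGraph V)
    (hG : G.MemLambda n) (huni : G.IsUnicyclic)
    (A : G.Subgraph) (hA : G.IsArm A) (e : G.edgeSet) (he : (e : Sym2 V) ∈ A.edgeSet) :
    ∀ (x : G.edgeSet) (c : (SimpleGraph.hLineGraph (SimpleGraph.pathGraph n) G).Walk x x),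
      c.IsCycle → e ∉ c.support := by
  classical
  intro x c hc hec
  obtain ⟨C, hC, K, rfl⟩ := hA
  have hw : ∀ w ∈ (e : Sym2 V), ∀ (x : V) (c : G.Walk x x), c.IsCycle → w ∉ c.support := by
    intro w hwe y d hd hwd
    have h1 := SimpleGraph.Subgraph.mem_verts_of_mem_edge he hwe
    obtain ⟨⟨v, hv⟩, -, rfl⟩ := h1
    -- By uniqueness, every cycle is the one whose vertices were deleted to form the arm.
    have h2 : d.toSubgraph = C := huni.2.unique ⟨y, d, hd, rfl⟩ hC
    exact hv (by rw [← h2]; exact d.mem_verts_toSubgraph.2 hwd)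
  have hc' := hc.rotate hec
  obtain ⟨-, w, hwe, hwf⟩ :=
    SimpleGraph.lineGraph_adj_iff_exists.1 ((c.rotate e hec).adj_snd hc'.not_nil).1
  exact SimpleGraph.not_memLambda_of_isCycle_at_vertex hn (hw w hwe) hc' (fun f hf =>
    SimpleGraph.mem_of_mem_support_of_isCycle (hw w hwe) hc' hwe hwf hf) hG
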